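/- For a polytope $P$ of dimension $d$ let $f(P,q)=\sum_{i=0}^{d} f_i(P)\,q^i$, where $f_i(P)$ is the number of (nonempty) $i$-dimensional faces of $P$, with $P$ itself counted as a face. For a finite simple graph $\Gamma=(V,E)$ with $V=\{1,\dots,n\}$ let $Z_\Gamma\subset\mathbb{R}^n$ be its graphical zonotope, i.e. the Minkowski sum of the segments $[-(e_i-e_j),\,e_i-e_j]$ over all edges $\{i,j\}\in E$ with $i<j$, where $e_1,\dots,e_n$ is the standard basis. (a) Let $\Gamma=\Gamma_1\vee_v\Gamma_2$ be the wedge of two finite connected simple graphs $\Gamma_1$ and $\Gamma_2$ at a common vertex $v$; that is, $\Gamma$ is the union of (copies of) $\Gamma_1$ and $\Gamma_2$, whose vertex sets have exactly the vertex $v$ in common. Then $f(Z_\Gamma,q)=f(Z_{\Gamma_1},q)\,f(Z_{\Gamma_2},q)$. (b) Consequently, for every tree $T$ on $n\ge 1$ vertices, $f(Z_T,q)=(q+2)^{n-1}$. -/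

import Mathlib

open scoped Pointwise

noncomputable section

namespace GraphicalZonotope

/-! ### Faces and the `f`-polynomial of a polytope -/

section Polytope

variable {E : Type*} [AddCommGroup E] [Module ℝ E] [TopologicalSpace E]

/-- The set of `i`-dimensional faces of a polytope `P`: the nonempty sets of the form
`{x ∈ P | l x is maximal on P}` for a linear functional `l` (so `P` itself is a face, by `l = 0`),
whose affine hull has dimension `i`. -/
def faces (P : Set E) (i : ℕ) : Set (Set E) :=
  {F | IsExposed ℝ P F ∧ F.Nonempty ∧ Module.finrank ℝ (vectorSpan ℝ F) = i}

/-- The number `f_i(P)` of `i`-dimensional faces of `P`. -/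
def faceCount (P : Set E) (i : ℕ) : ℕ := (faces P i).ncard

/-- The dimension of a nonempty polytope, i.e. the dimension of its affine hull. -/
def dimension (P : Set E) : ℕ := Module.finrank ℝ (vectorSpan ℝ P)

open Polynomial in
/-- The `f`-polynomial `f(P, q) = ∑_{i=0}^{dim P} f_i(P) q^i`. -/
def fPolynomial (P : Set E) : ℤ[X] :=
  ∑ i ∈ Finset.range (dimension P + 1), (faceCount P i : ℤ[X]) * X ^ i

/-- The zonotope `Z(v_1, …, v_m) = [-v_1, v_1] + ⋯ + [-v_m, v_m]` (a Minkowski sum). -/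
def zonotope {ι : Type*} [Fintype ι] (v : ι → E) : Set E :=
  ∑ k, segment ℝ (-v k) (v k)

end Polytope

/-! ### Graphical zonotopes -/

section Graph

variable {V : Type*}

open Classical in
/-- The segment `[-(e_i - e_j), e_i - e_j]` in `ℝ^V` attached to a pair `{i, j}`. It does not
depend on the order of `i` and `j`. -/
def edgeSegment : Sym2 V → Set (V → ℝ) :=
  Sym2.lift ⟨fun i j => segment ℝ (-(Pi.single i (1 : ℝ) - Pi.single j 1))
    (Pi.single i (1 : ℝ) - Pi.single j 1), fun i j => by
      beta_reduce
      rw [segment_symm, neg_sub, neg_sub]⟩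

open Classical in
/-- The graphical zonotope of a finite simple graph `Γ` on the vertex set `V`: the Minkowski sum
in `ℝ^V` of the segments `[-(e_i - e_j), e_i - e_j]` over all edges `{i, j}` of `Γ`. -/
def graphicalZonotope [Fintype V] (Γ : SimpleGraph V) : Set (V → ℝ) :=
  ∑ e ∈ Γ.edgeFinset, edgeSegment e

open Classical in
/-- For every enumeration (linear order) of the vertices,
`graphicalZonotope Γ` is the zonotope `Z(e_i - e_j | i < j, {i, j} ∈ E)`. -/
theorem graphicalZonotope_eq_zonotope [Fintype V] [LinearOrder V] (Γ : SimpleGraph V) :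
    graphicalZonotope Γ = zonotope (fun p : {p : V × V // p.1 < p.2 ∧ Γ.Adj p.1 p.2} =>
      (Pi.single p.1.1 (1 : ℝ) - Pi.single p.1.2 1 : V → ℝ)) := by
  unfold graphicalZonotope zonotope
  symm
  refine Finset.sum_bij (fun p _ => s(p.1.1, p.1.2)) ?_ ?_ ?_ ?_
  · intro p _
    simpa using p.2.2
  · rintro ⟨⟨a, b⟩, hab, _⟩ _ ⟨⟨c, d⟩, hcd, _⟩ _ h
    simp only [Sym2.eq_iff] at h
    rcases h with ⟨rfl, rfl⟩ | ⟨rfl, rfl⟩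
    · rfl
    · exact absurd hab (lt_asymm hcd)
  · intro e he
    induction e using Sym2.ind with
    | _ a b =>
      have hab : Γ.Adj a b := by simpa using he
      rcases lt_or_gt_of_ne hab.ne with h | h
      · exact ⟨⟨(a, b), h, hab⟩, Finset.mem_univ _, rfl⟩
      · exact ⟨⟨(b, a), h, hab.symm⟩, Finset.mem_univ _, Sym2.eq_swap⟩
  · intro p _
    simp only [edgeSegment, Sym2.lift_mk]
    congr!

/-- A graphical zonotope has finitely many faces, so `faceCount` is a genuine count. -/
theorem finite_faces [Fintype V] (Γ : SimpleGraph V) (i : ℕ) :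
    (faces (graphicalZonotope Γ) i).Finite := by
  classical
  obtain ⟨S, hSfin, hS⟩ : ∃ S : Set (V → ℝ), S.Finite ∧
      graphicalZonotope Γ = convexHull ℝ S := by
    have key : ∀ e : Sym2 V, ∃ T : Set (V → ℝ), T.Finite ∧ edgeSegment e = convexHull ℝ T := by
      intro e
      induction e using Sym2.ind with
      | _ a b => exact ⟨{_, _}, by simp, (convexHull_pair _ _).symm⟩
    choose T hT hT' using key
    refine ⟨∑ e ∈ Γ.edgeFinset, T e, ?_, ?_⟩
    · refine Finset.sum_induction _ Set.Finite (fun _ _ => Set.Finite.add)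
        (Set.finite_singleton 0) (fun e _ => hT e)
    · rw [convexHull_sum, graphicalZonotope]
      exact Finset.sum_congr (by congr!) fun e _ => hT' e
  rw [hS]
  have hcomp : IsCompact (convexHull ℝ S) := hSfin.isCompact_convexHull ℝ
  refine Set.Finite.of_finite_image (f := fun F => F.extremePoints ℝ)
    (hSfin.finite_subsets.subset ?_) ?_
  · rintro _ ⟨F, hF, rfl⟩
    exact (hF.1.isExtreme.extremePoints_subset_extremePoints).trans
      extremePoints_convexHull_subset
  · intro F hF G hG h
    have h' : F.extremePoints ℝ = G.extremePoints ℝ := h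
    rw [← closure_convexHull_extremePoints (hF.1.isCompact hcomp)
        (hF.1.convex (convex_convexHull ℝ S)),
      ← closure_convexHull_extremePoints (hG.1.isCompact hcomp)
        (hG.1.convex (convex_convexHull ℝ S)), h']

/-- `Γ` is the wedge `Γ₁ ∨_v Γ₂` of `Γ₁` and `Γ₂` at the common vertex `v`: for copies
`i₁ : V₁ ↪ V` and `i₂ : V₂ ↪ V` of the two vertex sets, which cover `V` and have exactly the
vertex `v` in common, the graph `Γ` is the union of the copies of `Γ₁` and `Γ₂`. -/
structure IsWedge {V₁ V₂ : Type*} (Γ : SimpleGraph V) (v : V)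
    (Γ₁ : SimpleGraph V₁) (i₁ : V₁ ↪ V) (Γ₂ : SimpleGraph V₂) (i₂ : V₂ ↪ V) : Prop where
  cover : Set.range i₁ ∪ Set.range i₂ = Set.univ
  common : Set.range i₁ ∩ Set.range i₂ = {v}
  eq_union : Γ = Γ₁.map i₁ ⊔ Γ₂.map i₂

end Graph

end GraphicalZonotope

end

/-!
For a wedge `Γ = Γ₁ ∨_v Γ₂`, extension by zero of both factors gives a linear map
`L : ℝ^V₁ × ℝ^V₂ → ℝ^V` with `L(e_i - e_j, 0)` and `L(0, e_i - e_j)` the edge vectors of `Γ`. The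
edges of `Γ` are the disjoint union of those of `Γ₁` and `Γ₂`, so `Z_Γ = L(Z_Γ₁ × Z_Γ₂)`
(`IsWedge.graphicalZonotope_eq`). Although `L` has a kernel, coming from the two copies of `v`, it
is injective on pairs of vectors with coordinate sum zero (`IsWedge.injOn_coprod`), and graphical
zonotopes consist of such vectors. Hence `Z_Γ` is linearly isomorphic to `Z_Γ₁ × Z_Γ₂`.

It remains to see that the `f`-polynomial is invariant under linear maps that are injective on a
subspace containing the polytope (`fPolynomial_image`) and multiplicative on products
(`fPolynomial_prod`). Both follow from writing it as `∑ q ^ dim F` over all faces `F`: a functional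
on the subspace extends along `L`, so faces correspond to faces; and a functional on a product is a
sum of functionals on the factors, so the faces of `P × Q` are the products of faces of `P` and `Q`.

A tree with at least two vertices is the wedge of a smaller tree and a single edge, at the
neighbour of a leaf (`isWedge_of_existsUnique_adj`). The zonotope of an edge is a segment, with
`f`-polynomial `q + 2`, and the formula for trees follows by induction.
-/

open scoped Pointwise

noncomputable section

namespace GraphicalZonotope

open Polynomial

/-! ### Dimension -/

section Dimension

variable {E F : Type*} [AddCommGroup E] [Module ℝ E] [AddCommGroup F] [Module ℝ F]

theorem dimension_mono [FiniteDimensional ℝ E] {F P : Set E} (h : F ⊆ P) :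
    dimension F ≤ dimension P :=
  Submodule.finrank_mono (vectorSpan_mono ℝ h)

theorem dimension_singleton (x : E) :
    dimension ({x} : Set E) = 0 := by
  simp [dimension]

theorem dimension_Icc : dimension (Set.Icc (-1 : ℝ) 1) = 1 := by
  have h : vectorSpan ℝ (Set.Icc (-1 : ℝ) 1) = ⊤ := by
    refine eq_top_iff.2 fun x _ => ?_
    have h10 := vsub_mem_vectorSpan ℝ (s := Set.Icc (-1 : ℝ) 1) (p₁ := 1) (p₂ := 0)
      (by simp) (by simp)
    simpa using Submodule.smul_mem _ x h10
  rw [dimension, h, finrank_top, Module.finrank_self]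

theorem dimension_image {L : E →ₗ[ℝ] F} {S : Submodule ℝ E} (hL : Set.InjOn L S) {A : Set E}
    (hA : A ⊆ S) : dimension (L '' A) = dimension A := by
  have hspan : vectorSpan ℝ A ≤ S := by
    rw [vectorSpan_def, Submodule.span_le]
    rintro _ ⟨x, hx, y, hy, rfl⟩
    exact S.sub_mem (hA hx) (hA hy)
  have hmap : vectorSpan ℝ (L '' A) = (vectorSpan ℝ A).map L :=
    L.toAffineMap.map_vectorSpan.symm
  rw [dimension, dimension, hmap, ← LinearMap.range_domRestrict]
  refine LinearMap.finrank_range_of_inj fun x y hxy => Subtype.ext ?_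
  exact hL (hspan x.2) (hspan y.2) hxy

theorem dimension_prod [FiniteDimensional ℝ E] [FiniteDimensional ℝ F] {A : Set E} {B : Set F}
    (hA : A.Nonempty) (hB : B.Nonempty) : dimension (A ×ˢ B) = dimension A + dimension B := by
  have h : vectorSpan ℝ (A ×ˢ B) = (vectorSpan ℝ A).prod (vectorSpan ℝ B) := by
    simp only [vectorSpan_def, Set.prod_vsub_prod_comm]
    obtain ⟨a, ha⟩ := hA
    obtain ⟨b, hb⟩ := hB
    exact Submodule.span_prod_eq ℝ ⟨a, ha, a, ha, sub_self a⟩ ⟨b, hb, b, hb, sub_self b⟩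
  let e : (vectorSpan ℝ A).prod (vectorSpan ℝ B) ≃ₗ[ℝ] vectorSpan ℝ A × vectorSpan ℝ B :=
    { AddSubmonoid.prodEquiv (vectorSpan ℝ A).toAddSubmonoid (vectorSpan ℝ B).toAddSubmonoid with
      map_smul' := fun _ _ => rfl }
  rw [dimension, h, e.finrank_eq, Module.finrank_prod]
  rfl

end Dimension

/-! ### The set of all faces -/

section Faces

variable {E : Type*} [AddCommGroup E] [Module ℝ E] [TopologicalSpace E]

/-- The set of all nonempty exposed faces of `P`, of any dimension. -/
def allFaces (P : Set E) : Set (Set E) :=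
  {F | IsExposed ℝ P F ∧ F.Nonempty}

theorem mem_allFaces {P F : Set E} :
    F ∈ allFaces P ↔ F.Nonempty ∧ ∃ l : StrongDual ℝ E, F = {x ∈ P | ∀ y ∈ P, l y ≤ l x} :=
  ⟨fun h => ⟨h.2, h.1 h.2⟩, fun h => ⟨fun _ => h.2, h.1⟩⟩

theorem dimension_le_of_mem_allFaces [FiniteDimensional ℝ E] {P F : Set E}
    (h : F ∈ allFaces P) : dimension F ≤ dimension P :=
  dimension_mono h.1.subset

theorem finite_allFaces [FiniteDimensional ℝ E] {P : Set E} (h : ∀ i, (faces P i).Finite) :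
    (allFaces P).Finite := by
  refine ((Set.finite_Iic (dimension P)).biUnion fun i _ => h i).subset fun F hF => ?_
  exact Set.mem_biUnion (x := dimension F) (dimension_le_of_mem_allFaces hF) ⟨hF.1, hF.2, rfl⟩

/-- The `f`-polynomial as a generating function over all faces. Products and linear images of
polytopes are compared in this form. -/
theorem fPolynomial_eq_sum [FiniteDimensional ℝ E] {P : Set E} (h : (allFaces P).Finite) :
    fPolynomial P = ∑ F ∈ h.toFinset, (X : ℤ[X]) ^ dimension F := by
  classical
  rw [fPolynomial, ← Finset.sum_fiberwise_of_maps_to (g := dimension)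
    (t := Finset.range (dimension P + 1))]
  · refine Finset.sum_congr rfl fun i _ => ?_
    have hc : faceCount P i = (h.toFinset.filter fun F => dimension F = i).card := by
      rw [faceCount, ← Set.ncard_coe_finset]
      congr 1
      ext F
      rw [Finset.mem_coe, Finset.mem_filter, h.mem_toFinset]
      exact and_assoc.symm
    rw [Finset.sum_congr rfl (g := fun _ => (X : ℤ[X]) ^ i)
      fun F hF => by rw [(Finset.mem_filter.1 hF).2], Finset.sum_const, hc, nsmul_eq_mul]
  · intro F hF
    have := dimension_le_of_mem_allFaces (h.mem_toFinset.1 hF)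
    simpa [Nat.lt_succ_iff] using this

end Faces

/-! ### Linear images -/

section LinearImage

variable {E F : Type*}
  [AddCommGroup E] [Module ℝ E] [TopologicalSpace E] [IsTopologicalAddGroup E]
  [ContinuousSMul ℝ E] [T2Space E] [FiniteDimensional ℝ E]
  [AddCommGroup F] [Module ℝ F] [TopologicalSpace F] [IsTopologicalAddGroup F]
  [ContinuousSMul ℝ F] [T2Space F] [FiniteDimensional ℝ F]

/-- Functionals on `E` factor through `L` after restriction to a subspace on which `L` is
injective, so `L` induces a bijection between the faces of a set in that subspace and the faces of
its image. -/
theorem bijOn_image_allFaces {L : E →ₗ[ℝ] F} {S : Submodule ℝ E} (hL : Set.InjOn L S)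
    {P : Set E} (hP : P ⊆ S) : Set.BijOn (L '' ·) (allFaces P) (allFaces (L '' P)) := by
  have himage : ∀ (l : E → ℝ) (m : F → ℝ), (∀ x ∈ P, m (L x) = l x) →
      L '' {x ∈ P | ∀ y ∈ P, l y ≤ l x} =
        {x ∈ L '' P | ∀ y ∈ L '' P, m y ≤ m x} := by
    intro l m hlm
    ext z
    constructor
    · rintro ⟨x, ⟨hx, hmax⟩, rfl⟩
      refine ⟨⟨x, hx, rfl⟩, ?_⟩
      rintro _ ⟨y, hy, rfl⟩
      rw [hlm y hy, hlm x hx]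
      exact hmax y hy
    · rintro ⟨⟨x, hx, rfl⟩, hmax⟩
      refine ⟨x, ⟨hx, fun y hy => ?_⟩, rfl⟩
      rw [← hlm y hy, ← hlm x hx]
      exact hmax _ ⟨y, hy, rfl⟩
  refine ⟨?_, ?_, ?_⟩
  · intro A hA
    obtain ⟨hne, l, rfl⟩ := mem_allFaces.1 hA
    obtain ⟨g, hg⟩ := (L.domRestrict S).exists_leftInverse_of_injective
      (LinearMap.ker_eq_bot.2 fun x y hxy => Subtype.ext (hL x.2 y.2 hxy))
    refine mem_allFaces.2 ⟨hne.image _,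
      LinearMap.toContinuousLinearMap (l.toLinearMap ∘ₗ S.subtype ∘ₗ g), himage _ _ ?_⟩
    intro x hx
    have := LinearMap.congr_fun hg ⟨x, hP hx⟩
    simp only [LinearMap.comp_apply, LinearMap.domRestrict_apply, LinearMap.id_apply] at this
    simp [this]
  · intro A hA B hB hAB
    exact (hL.image_eq_image_iff (hA.1.subset.trans hP) (hB.1.subset.trans hP)).1 hAB
  · intro B hB
    obtain ⟨hne, m, rfl⟩ := mem_allFaces.1 hB
    have h := himage (fun x => m (L x)) m fun _ _ => rfl
    refine ⟨{x ∈ P | ∀ y ∈ P, m (L y) ≤ m (L x)}, mem_allFaces.2 ⟨?_,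
      LinearMap.toContinuousLinearMap (m.toLinearMap ∘ₗ L), rfl⟩, h⟩
    rw [← h] at hne
    exact hne.of_image

theorem fPolynomial_image {L : E →ₗ[ℝ] F} {S : Submodule ℝ E} (hL : Set.InjOn L S)
    {P : Set E} (hP : P ⊆ S) (hfin : (allFaces P).Finite) :
    fPolynomial (L '' P) = fPolynomial P := by
  have hbij := bijOn_image_allFaces hL hP
  have hfin' : (allFaces (L '' P)).Finite := hbij.image_eq ▸ hfin.image _
  rw [fPolynomial_eq_sum hfin, fPolynomial_eq_sum hfin']
  symm
  refine Finset.sum_bij (fun A _ => L '' A) ?_ ?_ ?_ ?_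
  · intro A hA
    exact hfin'.mem_toFinset.2 (hbij.mapsTo (hfin.mem_toFinset.1 hA))
  · intro A hA B hB h
    exact hbij.injOn (hfin.mem_toFinset.1 hA) (hfin.mem_toFinset.1 hB) h
  · intro B hB
    obtain ⟨A, hA, rfl⟩ := hbij.surjOn (hfin'.mem_toFinset.1 hB)
    exact ⟨A, hfin.mem_toFinset.2 hA, rfl⟩
  · intro A hA
    rw [dimension_image hL ((hfin.mem_toFinset.1 hA).1.subset.trans hP)]

end LinearImage

/-! ### Products -/

section Product

variable {E F : Type*}
  [AddCommGroup E] [Module ℝ E] [TopologicalSpace E]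
  [AddCommGroup F] [Module ℝ F] [TopologicalSpace F]

/-- The faces of a product are the products of faces, because a functional on the product attains
its maximum where both of its components do. -/
theorem allFaces_prod [ContinuousAdd E] [ContinuousAdd F] (P : Set E) (Q : Set F) :
    allFaces (P ×ˢ Q) = Set.image2 (· ×ˢ ·) (allFaces P) (allFaces Q) := by
  have hprod : ∀ (l : E → ℝ) (m : F → ℝ),
      {z ∈ P ×ˢ Q | ∀ w ∈ P ×ˢ Q, l w.1 + m w.2 ≤ l z.1 + m z.2} =
        {x ∈ P | ∀ y ∈ P, l y ≤ l x} ×ˢ {x ∈ Q | ∀ y ∈ Q, m y ≤ m x} := by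
    intro l m
    ext ⟨x, y⟩
    constructor
    · rintro ⟨⟨hx, hy⟩, hmax⟩
      exact ⟨⟨hx, fun x' hx' => by simpa using hmax (x', y) ⟨hx', hy⟩⟩,
        ⟨hy, fun y' hy' => by simpa using hmax (x, y') ⟨hx, hy'⟩⟩⟩
    · rintro ⟨⟨hx, hxmax⟩, ⟨hy, hymax⟩⟩
      exact ⟨⟨hx, hy⟩, fun w hw => add_le_add (hxmax _ hw.1) (hymax _ hw.2)⟩
  ext C
  constructor
  · intro hC
    obtain ⟨hne, l, rfl⟩ := mem_allFaces.1 hC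
    -- The functional `l` splits as a sum of functionals on the two factors.
    have hl : ∀ z : E × F, l z = l (z.1, 0) + l (0, z.2) := fun z => by
      rw [← map_add, Prod.mk_add_mk, add_zero, zero_add]
    have heq : {z ∈ P ×ˢ Q | ∀ w ∈ P ×ˢ Q, l w ≤ l z} =
        {x ∈ P | ∀ y ∈ P, l (y, 0) ≤ l (x, 0)} ×ˢ {x ∈ Q | ∀ y ∈ Q, l (0, y) ≤ l (0, x)} := by
      rw [← hprod (fun x => l (x, 0)) (fun y => l (0, y))]
      simp only [← hl]
    rw [heq] at hne ⊢
    exact Set.mem_image2_of_mem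
      (mem_allFaces.2 ⟨hne.fst, l.comp (ContinuousLinearMap.inl ℝ E F), rfl⟩)
      (mem_allFaces.2 ⟨hne.snd, l.comp (ContinuousLinearMap.inr ℝ E F), rfl⟩)
  · rintro ⟨A, hA, B, hB, rfl⟩
    obtain ⟨hAne, l, rfl⟩ := mem_allFaces.1 hA
    obtain ⟨hBne, m, rfl⟩ := mem_allFaces.1 hB
    exact mem_allFaces.2 ⟨hAne.prod hBne, l.coprod m, (hprod l m).symm⟩

theorem finite_allFaces_prod [ContinuousAdd E] [ContinuousAdd F] {P : Set E} {Q : Set F}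
    (hP : (allFaces P).Finite) (hQ : (allFaces Q).Finite) : (allFaces (P ×ˢ Q)).Finite := by
  rw [allFaces_prod]
  exact hP.image2 _ hQ

theorem fPolynomial_prod [ContinuousAdd E] [ContinuousAdd F] [FiniteDimensional ℝ E]
    [FiniteDimensional ℝ F] {P : Set E} {Q : Set F}
    (hP : (allFaces P).Finite) (hQ : (allFaces Q).Finite) :
    fPolynomial (P ×ˢ Q) = fPolynomial P * fPolynomial Q := by
  have hPQ := finite_allFaces_prod hP hQ
  rw [fPolynomial_eq_sum hP, fPolynomial_eq_sum hQ, fPolynomial_eq_sum hPQ,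
    Finset.sum_mul_sum, ← Finset.sum_product']
  symm
  refine Finset.sum_bij (fun p _ => p.1 ×ˢ p.2) ?_ ?_ ?_ ?_
  · rintro ⟨A, B⟩ h
    simp only [Finset.mem_product, Set.Finite.mem_toFinset, allFaces_prod] at h ⊢
    exact Set.mem_image2_of_mem h.1 h.2
  · rintro ⟨A, B⟩ h ⟨A', B'⟩ _ heq
    simp only [Finset.mem_product, Set.Finite.mem_toFinset] at h
    have := (Set.prod_eq_prod_iff_of_nonempty (h.1.2.prod h.2.2)).1 heq
    exact Prod.ext this.1 this.2
  · intro C hC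
    simp only [Set.Finite.mem_toFinset, allFaces_prod] at hC
    obtain ⟨A, hA, B, hB, rfl⟩ := hC
    exact ⟨(A, B), by simp [hA, hB], rfl⟩
  · rintro ⟨A, B⟩ h
    simp only [Finset.mem_product, Set.Finite.mem_toFinset] at h
    rw [dimension_prod h.1.2 h.2.2, pow_add]

end Product

/-! ### Wedges of graphs -/

section Wedge

variable {V W : Type*}

/-- The linear map `ℝ^W → ℝ^V` sending `e_w` to `e_{i w}`. -/
abbrev pushforward (i : W ↪ V) : (W → ℝ) →ₗ[ℝ] (V → ℝ) :=
  Function.ExtendByZero.linearMap ℝ i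

theorem pushforward_apply (i : W ↪ V) (x : W → ℝ) (w : W) : pushforward i x (i w) = x w :=
  i.injective.extend_apply _ _ _

theorem pushforward_apply_of_notMem (i : W ↪ V) (x : W → ℝ) {a : V} (ha : a ∉ Set.range i) :
    pushforward i x a = 0 :=
  Function.extend_apply' _ _ _ ha

open Classical in
theorem pushforward_single (i : W ↪ V) (w : W) :
    pushforward i (Pi.single w 1) = Pi.single (i w) 1 := by
  ext a
  by_cases ha : a ∈ Set.range i
  · obtain ⟨b, rfl⟩ := ha
    rw [pushforward_apply]
    simp [Pi.single_apply]
  · rw [pushforward_apply_of_notMem i _ ha, Pi.single_eq_of_ne]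
    rintro rfl
    exact ha ⟨w, rfl⟩

theorem pushforward_image_edgeSegment (i : W ↪ V) (e : Sym2 W) :
    pushforward i '' edgeSegment e = edgeSegment (e.map i) := by
  classical
  induction e using Sym2.ind with
  | _ a b =>
    simp only [edgeSegment, Sym2.map_mk, Sym2.lift_mk]
    rw [← LinearMap.coe_toAffineMap, image_segment]
    simp only [LinearMap.coe_toAffineMap, map_neg, map_sub, pushforward_single]

open Classical in
theorem sum_edgeSegment_map [Fintype V] [Fintype W] (Γ : SimpleGraph W) (i : W ↪ V) :
    ∑ e ∈ (Γ.map i).edgeFinset, edgeSegment e = pushforward i '' graphicalZonotope Γ := by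
  have h : (Γ.map i).edgeFinset = Γ.edgeFinset.map i.sym2Map := by
    ext e
    simp
  rw [h, Finset.sum_map, graphicalZonotope, Set.image_finsetSum]
  exact Finset.sum_congr rfl fun e _ => (pushforward_image_edgeSegment i e).symm

/-- The hyperplane of vectors in `ℝ^V` with coordinate sum zero. -/
def sumZero (V : Type*) [Fintype V] : Submodule ℝ (V → ℝ) :=
  LinearMap.ker (∑ a, LinearMap.proj a : (V → ℝ) →ₗ[ℝ] ℝ)

theorem mem_sumZero [Fintype V] {x : V → ℝ} : x ∈ sumZero V ↔ ∑ a, x a = 0 := by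
  simp [sumZero]

theorem edgeSegment_subset_sumZero [Fintype V] (e : Sym2 V) :
    edgeSegment e ⊆ (sumZero V : Set (V → ℝ)) := by
  classical
  induction e using Sym2.ind with
  | _ a b =>
    have h : (Pi.single a 1 - Pi.single b 1 : V → ℝ) ∈ sumZero V := by
      simp [mem_sumZero]
    exact (sumZero V).convex.segment_subset ((sumZero V).neg_mem h) h

theorem graphicalZonotope_subset_sumZero [Fintype V] (Γ : SimpleGraph V) :
    graphicalZonotope Γ ⊆ (sumZero V : Set (V → ℝ)) := by
  classical
  refine Finset.sum_induction _ (fun A : Set (V → ℝ) => A ⊆ (sumZero V : Set (V → ℝ))) ?_ ?_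
    fun e _ => edgeSegment_subset_sumZero e
  · rintro A B hA hB _ ⟨x, hx, y, hy, rfl⟩
    exact (sumZero V).add_mem (hA hx) (hB hy)
  · rintro _ rfl
    exact (sumZero V).zero_mem

theorem finite_allFaces_graphicalZonotope [Fintype V] (Γ : SimpleGraph V) :
    (allFaces (graphicalZonotope Γ)).Finite :=
  finite_allFaces (finite_faces Γ)

variable {V₁ V₂ : Type*} [Fintype V₁] {v : V} {i₁ : V₁ ↪ V} {i₂ : V₂ ↪ V}

/-- If the ranges of `i` and `j` meet only in `v` and the pushforwards of `x` and `y` cancel, then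
`x` can be nonzero only over `v`; as its coordinates sum to zero, it vanishes. -/
theorem eq_zero_of_pushforward_add_eq_zero (hcommon : Set.range i₁ ∩ Set.range i₂ = {v})
    {x : V₁ → ℝ} {y : V₂ → ℝ} (hx : x ∈ sumZero V₁)
    (h : pushforward i₁ x + pushforward i₂ y = 0) : x = 0 := by
  classical
  obtain ⟨v₁, hv₁⟩ : v ∈ Set.range i₁ :=
    (hcommon.symm ▸ Set.mem_singleton v : v ∈ Set.range i₁ ∩ Set.range i₂).1
  have hne : ∀ a, a ≠ v₁ → x a = 0 := by
    intro a ha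
    have hnot : i₁ a ∉ Set.range i₂ := fun h₂ => ha <| i₁.injective <| by
      have : i₁ a ∈ Set.range i₁ ∩ Set.range i₂ := ⟨⟨a, rfl⟩, h₂⟩
      rw [hcommon] at this
      exact this.trans hv₁.symm
    have := congrFun h (i₁ a)
    rwa [Pi.add_apply, pushforward_apply, pushforward_apply_of_notMem i₂ y hnot, add_zero] at this
  have hv : x v₁ = 0 := by
    rw [mem_sumZero, Fintype.sum_eq_single v₁ hne] at hx
    exact hx
  ext a
  by_cases ha : a = v₁
  · rw [ha, hv, Pi.zero_apply]
  · exact hne a ha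

variable [Fintype V₂]
  {Γ : SimpleGraph V} {Γ₁ : SimpleGraph V₁} {Γ₂ : SimpleGraph V₂}

theorem IsWedge.injOn_coprod (h : IsWedge Γ v Γ₁ i₁ Γ₂ i₂) :
    Set.InjOn ((pushforward i₁).coprod (pushforward i₂))
      ((sumZero V₁).prod (sumZero V₂) : Submodule ℝ ((V₁ → ℝ) × (V₂ → ℝ))) := by
  intro p hp q hq hpq
  have hd := ((sumZero V₁).prod (sumZero V₂)).sub_mem hp hq
  rw [← sub_eq_zero, ← map_sub, LinearMap.coprod_apply] at hpq
  have h₁ := eq_zero_of_pushforward_add_eq_zero h.common hd.1 hpq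
  have h₂ := eq_zero_of_pushforward_add_eq_zero (Set.inter_comm _ _ ▸ h.common) hd.2
    ((add_comm _ _).trans hpq)
  exact sub_eq_zero.1 (Prod.ext h₁ h₂)

variable [Fintype V]

theorem IsWedge.graphicalZonotope_eq (h : IsWedge Γ v Γ₁ i₁ Γ₂ i₂) :
    graphicalZonotope Γ = (pushforward i₁).coprod (pushforward i₂) ''
      (graphicalZonotope Γ₁ ×ˢ graphicalZonotope Γ₂) := by
  classical
  have hE : Γ.edgeFinset = (Γ₁.map i₁).edgeFinset ∪ (Γ₂.map i₂).edgeFinset := by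
    ext e
    rw [Finset.mem_union]
    simp only [SimpleGraph.mem_edgeFinset, h.eq_union, SimpleGraph.edgeSet_sup, Set.mem_union]
  -- An edge in both copies would have both of its ends equal to `v`.
  have hdisj : Disjoint (Γ₁.map i₁).edgeFinset (Γ₂.map i₂).edgeFinset := by
    rw [Finset.disjoint_left]
    intro e
    induction e using Sym2.ind with
    | _ a b =>
      simp only [SimpleGraph.mem_edgeFinset, SimpleGraph.mem_edgeSet, SimpleGraph.map_adj]
      rintro ⟨a₁, b₁, hab, rfl, rfl⟩ ⟨a₂, b₂, -, ha, hb⟩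
      have hcommon : ∀ c, c ∈ Set.range i₁ → c ∈ Set.range i₂ → c = v := fun c h₁ h₂ => by
        have : c ∈ Set.range i₁ ∩ Set.range i₂ := ⟨h₁, h₂⟩
        rwa [h.common] at this
      exact hab.ne (i₁.injective ((hcommon _ ⟨_, rfl⟩ ⟨_, ha⟩).trans
        (hcommon _ ⟨_, rfl⟩ ⟨_, hb⟩).symm))
  have hsum : graphicalZonotope Γ = pushforward i₁ '' graphicalZonotope Γ₁ +
      pushforward i₂ '' graphicalZonotope Γ₂ := by
    rw [← sum_edgeSegment_map, ← sum_edgeSegment_map, ← Finset.sum_union hdisj, ← hE,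
      graphicalZonotope]
  rw [hsum]
  ext z
  simp only [Set.mem_add, Set.mem_image, Set.mem_prod, Prod.exists, LinearMap.coprod_apply]
  constructor
  · rintro ⟨_, ⟨x, hx, rfl⟩, _, ⟨y, hy, rfl⟩, rfl⟩
    exact ⟨x, y, ⟨hx, hy⟩, rfl⟩
  · rintro ⟨x, y, ⟨hx, hy⟩, rfl⟩
    exact ⟨_, ⟨x, hx, rfl⟩, _, ⟨y, hy, rfl⟩, rfl⟩

theorem IsWedge.fPolynomial_graphicalZonotope (h : IsWedge Γ v Γ₁ i₁ Γ₂ i₂) :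
    fPolynomial (graphicalZonotope Γ) =
      fPolynomial (graphicalZonotope Γ₁) * fPolynomial (graphicalZonotope Γ₂) := by
  have h₁ := finite_allFaces_graphicalZonotope Γ₁
  have h₂ := finite_allFaces_graphicalZonotope Γ₂
  rw [h.graphicalZonotope_eq, fPolynomial_image h.injOn_coprod
    (Set.prod_mono (graphicalZonotope_subset_sumZero Γ₁) (graphicalZonotope_subset_sumZero Γ₂))
    (finite_allFaces_prod h₁ h₂), fPolynomial_prod h₁ h₂]

end Wedge

/-! ### Trees -/

section Tree

theorem allFaces_Icc : allFaces (Set.Icc (-1 : ℝ) 1) = {{-1}, {1}, Set.Icc (-1) 1} := by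
  ext F
  rw [mem_allFaces]
  constructor
  · rintro ⟨-, l, rfl⟩
    obtain ⟨c, hl⟩ : ∃ c, ∀ x : ℝ, l x = x * c := ⟨l 1, fun x => by
      rw [← smul_eq_mul, ← map_smul, smul_eq_mul, mul_one]⟩
    simp only [hl]
    rcases lt_trichotomy c 0 with h | h | h
    · left
      ext x
      simp only [Set.mem_ofPred_eq, Set.mem_Icc,
        Set.mem_singleton_iff, mul_le_mul_right_of_neg h]
      constructor
      · rintro ⟨⟨h₁, h₂⟩, hx⟩
        exact le_antisymm (hx (-1) ⟨le_rfl, by norm_num⟩) h₁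
      · rintro rfl
        exact ⟨⟨le_rfl, by norm_num⟩, fun y hy => hy.1⟩
    · right; right
      ext x
      simp [h]
    · right; left
      ext x
      simp only [Set.mem_ofPred_eq, Set.mem_Icc, Set.mem_singleton_iff, mul_le_mul_iff_left₀ h]
      constructor
      · rintro ⟨⟨h₁, h₂⟩, hx⟩
        exact le_antisymm h₂ (hx 1 ⟨by norm_num, le_rfl⟩)
      · rintro rfl
        exact ⟨⟨by norm_num, le_rfl⟩, fun y hy => hy.2⟩
  · rintro (rfl | rfl | rfl)
    · refine ⟨Set.singleton_nonempty _, -ContinuousLinearMap.id ℝ ℝ, ?_⟩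
      ext x
      simp only [Set.mem_singleton_iff, Set.mem_ofPred_eq, Set.mem_Icc,
        _root_.neg_apply, ContinuousLinearMap.id_apply, neg_le_neg_iff]
      constructor
      · rintro rfl
        exact ⟨⟨le_rfl, by norm_num⟩, fun y hy => hy.1⟩
      · rintro ⟨⟨h₁, h₂⟩, hx⟩
        exact le_antisymm (hx (-1) ⟨le_rfl, by norm_num⟩) h₁
    · refine ⟨Set.singleton_nonempty _, ContinuousLinearMap.id ℝ ℝ, ?_⟩
      ext x
      simp only [Set.mem_singleton_iff, Set.mem_ofPred_eq, Set.mem_Icc,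
        ContinuousLinearMap.id_apply]
      constructor
      · rintro rfl
        exact ⟨⟨by norm_num, le_rfl⟩, fun y hy => hy.2⟩
      · rintro ⟨⟨h₁, h₂⟩, hx⟩
        exact le_antisymm h₂ (hx 1 ⟨by norm_num, le_rfl⟩)
    · exact ⟨Set.nonempty_Icc.2 (by norm_num), 0, by ext; simp⟩

theorem finite_allFaces_Icc : (allFaces (Set.Icc (-1 : ℝ) 1)).Finite := by
  rw [allFaces_Icc]
  simp

theorem fPolynomial_Icc : fPolynomial (Set.Icc (-1 : ℝ) 1) = X + 2 := by
  classical
  have h : finite_allFaces_Icc.toFinset = {{-1}, {1}, Set.Icc (-1) 1} := by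
    ext F
    simp [allFaces_Icc]
  have h₁ : ({-1} : Set ℝ) ≠ {1} := by
    rw [Ne, Set.singleton_eq_singleton_iff]
    norm_num
  -- The two vertices differ from the whole interval because the dimensions differ.
  have h₂ : ∀ x : ℝ, ({x} : Set ℝ) ≠ Set.Icc (-1) 1 := fun x hx => by
    have := congrArg dimension hx
    rw [dimension_singleton, dimension_Icc] at this
    exact zero_ne_one this
  rw [fPolynomial_eq_sum finite_allFaces_Icc, h, Finset.sum_insert (by simp [h₁, h₂]),
    Finset.sum_pair (h₂ 1), dimension_singleton, dimension_singleton, dimension_Icc]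
  ring

theorem fPolynomial_segment_neg {E : Type*} [AddCommGroup E] [Module ℝ E] [TopologicalSpace E]
    [IsTopologicalAddGroup E] [ContinuousSMul ℝ E] [T2Space E] [FiniteDimensional ℝ E]
    {u : E} (hu : u ≠ 0) : fPolynomial (segment ℝ (-u) u) = X + 2 := by
  have h : segment ℝ (-u) u = LinearMap.toSpanSingleton ℝ E u '' Set.Icc (-1 : ℝ) 1 := by
    rw [← segment_eq_Icc (by norm_num), ← LinearMap.coe_toAffineMap, image_segment]
    simp
  rw [h, fPolynomial_image (S := ⊤) _ (Set.subset_univ _) finite_allFaces_Icc, fPolynomial_Icc]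
  intro a _ b _ hab
  exact smul_left_injective ℝ hu hab

theorem fPolynomial_singleton {E : Type*} [AddCommGroup E] [Module ℝ E] [TopologicalSpace E]
    [FiniteDimensional ℝ E] (x : E) : fPolynomial ({x} : Set E) = 1 := by
  have h : allFaces ({x} : Set E) = {{x}} := by
    ext F
    rw [mem_allFaces]
    constructor
    · rintro ⟨hne, l, rfl⟩
      exact hne.subset_singleton_iff.1 (Set.sep_subset _ _)
    · rintro rfl
      exact ⟨Set.singleton_nonempty x, 0, by simp⟩
  have hfin : (allFaces ({x} : Set E)).Finite := by
    rw [h]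
    exact Set.finite_singleton _
  have hF : hfin.toFinset = {{x}} := by
    ext F
    simp [h]
  rw [fPolynomial_eq_sum hfin, hF, Finset.sum_singleton, dimension_singleton, pow_zero]

theorem graphicalZonotope_of_subsingleton {V : Type*} [Fintype V] [Subsingleton V]
    (Γ : SimpleGraph V) : graphicalZonotope Γ = {0} := by
  classical
  have h : Γ.edgeFinset = ∅ := by
    rw [Subsingleton.elim Γ ⊥]
    ext e
    simp
  rw [graphicalZonotope, h, Finset.sum_empty]
  rfl

theorem fPolynomial_graphicalZonotope_top_bool :
    fPolynomial (graphicalZonotope (⊤ : SimpleGraph Bool)) = X + 2 := by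
  classical
  have hE : (⊤ : SimpleGraph Bool).edgeFinset = {s(true, false)} := by
    ext e
    induction e using Sym2.ind with
    | _ a b => cases a <;> cases b <;> simp
  have h : graphicalZonotope (⊤ : SimpleGraph Bool) = edgeSegment s(true, false) := by
    rw [graphicalZonotope, ← Finset.sum_singleton edgeSegment s(true, false), ← hE]
    -- The two sides use different instances of `Fintype` on the edge set.
    congr!
  rw [h, edgeSegment, Sym2.lift_mk]
  refine fPolynomial_segment_neg fun h0 => ?_
  have := congrFun h0 true
  simp at this

/-- A graph with a vertex `v` whose only neighbour is `w` is the wedge at `w` of the graph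
obtained by deleting `v` and a single edge. -/
theorem isWedge_of_existsUnique_adj {V : Type*} {Γ : SimpleGraph V} {v w : V} (hvw : Γ.Adj v w)
    (huniq : ∀ a, Γ.Adj v a → a = w) (j : Bool ↪ V) (hjt : j true = v) (hjf : j false = w) :
    IsWedge Γ w (Γ.induce {v}ᶜ) (Function.Embedding.subtype _) (⊤ : SimpleGraph Bool) j where
  cover := by
    ext a
    by_cases ha : a = v
    · simp [ha, ← hjt]
    · simp [ha]
  common := by
    ext a
    have := hvw.ne
    simp only [Function.Embedding.coe_subtype, Subtype.range_coe_subtype, Set.mem_inter_iff,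
      Set.mem_ofPred_eq, Set.mem_compl_iff, Set.mem_singleton_iff, Set.mem_range, Bool.exists_bool,
      hjt, hjf]
    grind
  eq_union := by
    ext a b
    have := hvw.symm
    simp only [SimpleGraph.sup_adj, SimpleGraph.map_adj, SimpleGraph.comap_adj,
      SimpleGraph.top_adj, Bool.exists_bool, hjt, hjf, Function.Embedding.subtype_apply,
      Subtype.exists, Set.mem_compl_iff, Set.mem_singleton_iff]
    constructor
    · intro hab
      by_cases ha : a = v
      · subst ha
        have := huniq b hab
        grind
      · by_cases hb : b = v
        · subst hb
          have := huniq a hab.symm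
          grind
        · exact Or.inl ⟨a, ha, b, hb, hab, rfl, rfl⟩
    · rintro (⟨c, hc, d, hd, h, rfl, rfl⟩ | h)
      · exact h
      · grind

theorem fPolynomial_graphicalZonotope_of_isTree {V : Type*} [Fintype V] (T : SimpleGraph V)
    (hT : T.IsTree) : fPolynomial (graphicalZonotope T) = (X + 2) ^ (Fintype.card V - 1) := by
  classical
  induction hn : Fintype.card V generalizing V with
  | zero =>
    have := hT.1.nonempty
    exact absurd hn Fintype.card_ne_zero
  | succ n ih =>
    rcases subsingleton_or_nontrivial V with hV | hV
    · have := Fintype.card_le_one_iff_subsingleton.2 hV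
      obtain rfl : n = 0 := by lia
      rw [graphicalZonotope_of_subsingleton, fPolynomial_singleton, zero_add, Nat.sub_self,
        pow_zero]
    · obtain ⟨v, hv⟩ := hT.exists_vert_degree_one_of_nontrivial
      obtain ⟨w, hvw, huniq⟩ := SimpleGraph.degree_eq_one_iff_existsUnique_adj.1 hv
      -- `j` embeds an edge as the one from the leaf `v` to its neighbour `w`.
      let j : Bool ↪ V := ⟨fun b => if b then v else w, by
        have := hvw.ne
        rintro (_ | _) (_ | _) h <;> simp_all⟩
      have hwedge := isWedge_of_existsUnique_adj hvw huniq j rfl rfl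
      have htree : (T.induce {v}ᶜ).IsTree :=
        ⟨hT.1.induce_compl_singleton_of_degree_eq_one hv, hT.2.induce _⟩
      have hcard : Fintype.card ({v}ᶜ : Set V) = n := by
        rw [Fintype.card_compl_set, hn]
        simp
      have hpos : n ≠ 0 := by
        have := Fintype.one_lt_card (α := V)
        lia
      rw [hwedge.fPolynomial_graphicalZonotope, ih _ htree hcard,
        fPolynomial_graphicalZonotope_top_bool, ← pow_succ]
      congr 1
      lia

end Tree

end GraphicalZonotope

end

open Polynomial GraphicalZonotope in
theorem mainTheorem3 :
    (∀ {V V₁ V₂ : Type*} [Fintype V] [Fintype V₁] [Fintype V₂]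
      (Γ : SimpleGraph V) (Γ₁ : SimpleGraph V₁) (Γ₂ : SimpleGraph V₂)
      (v : V) (i₁ : V₁ ↪ V) (i₂ : V₂ ↪ V),
      Γ₁.Connected → Γ₂.Connected → IsWedge Γ v Γ₁ i₁ Γ₂ i₂ →
        fPolynomial (graphicalZonotope Γ) =
          fPolynomial (graphicalZonotope Γ₁) * fPolynomial (graphicalZonotope Γ₂)) ∧
    (∀ {V : Type*} [Fintype V] (T : SimpleGraph V) (n : ℕ),
      T.IsTree → Fintype.card V = n →
        fPolynomial (graphicalZonotope T) = (X + 2) ^ (n - 1)) := by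
  exact ⟨fun _ _ _ _ _ _ _ _ h => h.fPolynomial_graphicalZonotope,
    fun T _ hT hn => hn ▸ fPolynomial_graphicalZonotope_of_isTree T hT⟩
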